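/- Binomial coefficients $\binom{a}{b}$ with integers $a,b$ are $0$ for $b<0$ and $a(a-1)\cdots(a-b+1)/b!$ for $b\ge 0$. For integers $r,s,x,y$ put $\phi_{r,s}(x,y)=\binom{s-r}{y-x}$ if $r<s$ and $\phi_{r,s}(x,y)=0$ otherwise. **The half-hexagon.** Let $n\ge 0$. Take the triangular lattice in skewed coordinates $(t,x)\in\mathbb Z^2$, with edges in the directions $(0,1)$, $(1,0)$, $(1,1)$. The order-$n$ Novak half-hexagon is the trapezoid $\{0\le t\le n+1,\ 1\le x\le n+1+t\}$ (sides $n$, $n+1$, $2n+1$, $n+1$) from which the $n+1$ unit triangles that have the segment from $(n+1,x)$ to $(n+1,x+1)$, $x=1,3,\dots,2n+1$, as a side are removed. A lozenge is the union of two unit triangles sharing a side, and a tiling is a set of lozenges in the region covering each of its unit triangles exactly once. A tiling has a *walker at time $t$ at position $x$* if the segment from $(t,x)$ to $(t,x+1)$ is a side of one of its lozenges (so the walkers are $n$ nonintersecting paths which start at $1,\dots,n$ at time $0$, stay or move one unit to the right at each step, and end at $2,4,\dots,2n$ at time $n+1$). **(1)** The set of tilings of the order-$n$ Novak half-hexagon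 is finite and nonempty, and the correlation functions of a uniformly random tiling are determinantal: for every $m\ge0$ and all pairwise distinct $(t_1,x_1),\dots,(t_m,x_m)$ with $t_a\in\{0,\dots,n+1\}$, $x_a\in\mathbb Z$, the probability that for each $a=1,\dots,m$ there is a walker at time $t_a$ at position $x_a$ equals $\det[K(t_a,x_a;t_b,x_b)]_{a,b=1}^m$, where $$K(r,x;s,y)=-\phi_{r,s}(x,y)+\sum_{i,j=1}^n\frac{\binom{n+1-r}{2i-x}\binom{s}{y-j}}{\binom{2n}{2i-1}}\sum_{k=1}^{j}\binom{2n}{k-1}\binom{n+j-k}{j-k}\frac{(-1)^{k+j+i+n}}{2^{n-1}(i-1)!\,(n-i)!}\prod_{l=1,\,l\ne i}^n(k-2l).$$ **(2)** More generally, let $n,N\ge 0$ and let $y_1,\dots,y_n$ be integers. Consider the configurations of $n$ walkers on $\mathbb Z$ at times $0,\dots,N$ that start at $1,\dots,n$, end at $y_1,\dots,y_n$, each stay or move one unit to the right at each step, and have strictly increasing positions $x^{(t)}_1<\dots<x^{(t)}_n$ at every time $t$. If there is at least one such configuration, then there are finitely many, and under the uniform distribution on them, for every $m\ge0$ and all pairwise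 distinct $(t_1,x_1),\dots,(t_m,x_m)$ with $t_a\in\{0,\dots,N\}$, $x_a\in\mathbb Z$, the probability that there is a walker at time $t_a$ at position $x_a$ for each $a$ equals $\det[K_{N,y}(t_a,x_a;t_b,x_b)]_{a,b=1}^m$, where $$K_{N,y}(r,x;s,z)=-\phi_{r,s}(x,z)+\sum_{i,j=1}^n\frac{\binom{N-r}{y_i-x}\binom{s}{z-j}}{\binom{N+n-1}{y_i-1}}\sum_{k=1}^{j}\binom{N+n-1}{k-1}\binom{N-1+j-k}{j-k}(-1)^{k+j}\prod_{l=1,\,l\ne i}^n\frac{k-y_l}{y_i-y_l}.$$ **(3)** For every $n\ge 0$ and all integers $r,x,s,y$, the kernel $K(r,x;s,y)$ of (1) is equal to $K_{N,(y_1,\dots,y_n)}(r,x;s,y)$ with $N=n+1$ and $y_i=2i$ for $i=1,\dots,n$. -/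

import Mathlib

namespace HalfHexagon

/-- The binomial coefficient `C(a, b)` for integers `a`, `b`, with the usual convention that it is
zero for `b < 0` (and hence also for `0 ≤ a < b`). -/
noncomputable def binom (a b : ℤ) : ℚ :=
  if 0 ≤ b then ((Ring.choose a b.toNat : ℤ) : ℚ) else 0

/-- `φ_{r,s}(x,y) = C(s - r, y - x)` for `r < s`, and `0` otherwise. -/
noncomputable def phi (r s x y : ℤ) : ℚ :=
  if r < s then binom (s - r) (y - x) else 0

/-- The probability of the event `E` under the uniform distribution on the finite nonempty
set `S`. -/
noncomputable def uniformProb {Ω : Type*} (S E : Set Ω) : ℚ :=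
  ((S ∩ E).ncard : ℚ) / (S.ncard : ℚ)

/-! ### Nonintersecting walkers -/

/-- The configurations of `n` nonintersecting walkers on the integer line, during the times
`0, …, N`: the walkers start densely packed at `1, …, n`, end at `y`, and at each tick of the clock
each of them stays or moves one step to the right. The `i`-th walker (in the numbering `1, …, n`)
has the index `i - 1` in `Fin n`. -/
def walks (n N : ℕ) (y : Fin n → ℤ) : Set (Fin (N + 1) → Fin n → ℤ) :=
  {w | (∀ t, StrictMono (w t)) ∧
    (∀ i, w 0 i = (i : ℕ) + 1) ∧
    (∀ i, w (Fin.last N) i = y i) ∧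
    ∀ (t : Fin N) (i : Fin n),
      w t.succ i = w t.castSucc i ∨ w t.succ i = w t.castSucc i + 1}

/-- The kernel for densely packed walkers with end time `N` and endpoints `y`; here `i`, `j`, `l`
in `Fin n` stand for the indices `i + 1`, `j + 1`, `l + 1` in `1, …, n`. -/
noncomputable def walkKernel (n N : ℕ) (y : Fin n → ℤ) (r x s z : ℤ) : ℚ :=
  -phi r s x z +
    ∑ i : Fin n, ∑ j : Fin n,
      binom (N - r) (y i - x) * binom s (z - ((j : ℕ) + 1)) / binom (N + n - 1) (y i - 1) *
        ∑ k ∈ Finset.Icc 1 ((j : ℕ) + 1),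
          binom (N + n - 1) ((k : ℤ) - 1) *
            binom (N - 1 + ((j : ℕ) + 1) - k) (((j : ℕ) + 1) - k) *
            (-1) ^ (k + ((j : ℕ) + 1)) *
            ∏ l ∈ Finset.univ.erase i, ((k : ℚ) - y l) / ((y i : ℚ) - y l)

/-- The kernel of the half-hexagon of order `n`. -/
noncomputable def novakKernel (n : ℕ) (r x s y : ℤ) : ℚ :=
  -phi r s x y +
    ∑ i ∈ Finset.Icc 1 n, ∑ j ∈ Finset.Icc 1 n,
      binom (n + 1 - r) (2 * i - x) * binom s (y - j) / binom (2 * n) (2 * i - 1) *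
        ∑ k ∈ Finset.Icc 1 j,
          binom (2 * n) ((k : ℤ) - 1) * binom (n + j - k) ((j : ℤ) - k) *
            ((-1) ^ (k + j + i + n) /
              (2 ^ (n - 1) * (Nat.factorial (i - 1) : ℚ) * (Nat.factorial (n - i) : ℚ))) *
            ∏ l ∈ (Finset.Icc 1 n).erase i, ((k : ℚ) - 2 * l)

/-! ### Lozenge tilings

The vertices of the triangular lattice are written as pairs `(t, x)` of integers, in coordinates
in which the edges of the lattice have the directions `(0, 1)`, `(1, 0)` and `(1, 1)`. Every unit
triangle has exactly one vertical side, that is, a side of the direction `(0, 1)`. -/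

/-- The unit triangles of the triangular lattice. `opensRight t x` and `opensLeft t x` are the two
triangles with the vertical side from `(t, x)` to `(t, x + 1)`: the first one lies in the
strip between the abscissas `t` and `t + 1`, the second one in the strip between `t - 1` and `t`. -/
inductive Tri : Type
  | opensRight (t x : ℤ) : Tri
  | opensLeft (t x : ℤ) : Tri

/-- The three vertices of a unit triangle. -/
def Tri.vertices : Tri → Finset (ℤ × ℤ)
  | .opensRight t x => {(t, x), (t, x + 1), (t + 1, x + 1)}
  | .opensLeft t x => {(t, x), (t, x + 1), (t - 1, x)}

/-- A lozenge is the union of two distinct unit triangles that share a side, that is, two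
vertices. -/
def IsLozenge (q : Set Tri) : Prop :=
  ∃ a b : Tri, a ≠ b ∧ (a.vertices ∩ b.vertices).card = 2 ∧ q = {a, b}

/-- The half-hexagon of order `n`: the trapezoid with the corners `(0, 1)`, `(0, n + 1)`,
`(n + 1, 1)`, `(n + 1, 2 * n + 2)`, whose sides have the lengths `n`, `n + 1`, `2 * n + 1`, `n + 1`,
without the `n + 1` unit triangles that have the first, third, …, last unit segment of the long side
as a side. -/
def region (n : ℕ) : Set Tri :=
  {a | (∀ v ∈ a.vertices, 0 ≤ v.1 ∧ v.1 ≤ n + 1 ∧ 1 ≤ v.2 ∧ v.2 ≤ n + 1 + v.1) ∧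
    ∀ x : ℤ, Odd x → a ≠ .opensLeft (n + 1) x}

/-- The lozenge tilings of the half-hexagon of order `n`: the sets of lozenges inside the region
such that every unit triangle of the region belongs to exactly one of them. -/
def tilings (n : ℕ) : Set (Set (Set Tri)) :=
  {T | (∀ q ∈ T, IsLozenge q ∧ q ⊆ region n) ∧ ∀ a ∈ region n, ∃! q, q ∈ T ∧ a ∈ q}

/-- In the tiling `T` there is a walker at time `t` at position `x`: the vertical unit segment from
`(t, x)` to `(t, x + 1)` is a side of one of the lozenges of `T`, i.e. some lozenge contains exactly
one of the two unit triangles on this segment. (The lozenges with vertical sides are those swept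
by the walkers: they join the segment `(t, x)` to the segment `(t + 1, x)` or `(t + 1, x + 1)`. The
vertical segments that are not met by a walker are the diagonals of the other lozenges.) -/
def HasWalker (T : Set (Set Tri)) (t x : ℤ) : Prop :=
  ∃ q ∈ T, Xor (Tri.opensRight t x ∈ q) (Tri.opensLeft t x ∈ q)

end HalfHexagon

/-!
Give the visits of the space-time points `(t_a, x_a)` the weights `1 + c_a`. Since every step has
length at most one, the total weight of the configurations of nonintersecting walkers is the
determinant of the total weights of single paths (Lindström, Gessel, Viennot). Splitting a path at
the last weighted point expands these weights around the path matrix `A` with the entries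
`C(N, y_i - j)`, and the total weight becomes `det A * det (1 + diag c * K)` with the Eynard-Mehta
kernel `K` built from `A⁻¹`. The coefficient of `∏ c_a`, extracted by inclusion-exclusion, is the
number of configurations that visit all the points on one side and `det A * det K` on the other.

The inverse of `A` is explicit because the quotient `C(N, v - j) / C(N + n - 1, v - 1)` is a
polynomial in `v` of degree less than `n`, hence is determined by its values at the `n` endpoints
through Lagrange interpolation; at the nodes `v = 1, …, n` instead of the endpoints, the matrix is
triangular and is inverted by Vandermonde's identity.

In a tiling of the half-hexagon, the lozenges without a vertical diagonal are the steps of `n`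
walkers, which start at `1, …, n` and are forced by the removed triangles to end at `2, 4, …, 2 n`.
-/

namespace HalfHexagon

/-! ### Binomial coefficients -/

lemma binom_of_neg {b : ℤ} (hb : b < 0) (a : ℤ) : binom a b = 0 :=
  if_neg hb.not_ge

lemma binom_natCast (a : ℤ) (b : ℕ) : binom a b = ((Ring.choose a b : ℤ) : ℚ) := by
  simp [binom]

lemma binom_natCast_natCast (a b : ℕ) : binom a b = (a.choose b : ℚ) := by
  rw [binom_natCast, Ring.choose_natCast, Int.cast_natCast]

lemma binom_zero_left (b : ℤ) : binom 0 b = if b = 0 then 1 else 0 := by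
  rcases lt_or_ge b 0 with hb | hb
  · rw [binom_of_neg hb, if_neg hb.ne]
  · lift b to ℕ using hb
    simp [binom_natCast, Ring.choose_zero_ite]

lemma binom_add_one (a b : ℤ) : binom (a + 1) b = binom a b + binom a (b - 1) := by
  rcases lt_trichotomy b 0 with hb | rfl | hb
  · rw [binom_of_neg hb, binom_of_neg hb, binom_of_neg (by omega), add_zero]
  · simp [binom]
  · obtain ⟨k, rfl⟩ : ∃ k : ℕ, b = (k + 1 : ℕ) := ⟨(b - 1).toNat, by omega⟩
    rw [show ((k + 1 : ℕ) : ℤ) - 1 = k by omega, binom_natCast, binom_natCast, binom_natCast,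
      Ring.choose_succ_succ, Int.cast_add, add_comm]

lemma binom_neg (a : ℤ) (b : ℕ) : binom (-a) b = binom (a - 1 + b) b * (-1) ^ b := by
  rw [binom_natCast, binom_natCast, Ring.choose_neg, Units.smul_def, Int.coe_negOnePow_natCast,
    smul_eq_mul, add_sub_right_comm]
  push_cast
  exact mul_comm _ _

lemma sum_range_binom_mul_binom (a b : ℤ) (d : ℕ) :
    ∑ k ∈ Finset.range (d + 1), binom a k * binom b (d - k) = binom (a + b) d := by
  rw [binom_natCast, Ring.add_choose_eq d (Commute.all a b),
    Finset.Nat.sum_antidiagonal_eq_sum_range_succ_mk, Int.cast_sum]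
  refine Finset.sum_congr rfl fun k hk => ?_
  rw [← Nat.cast_sub (Finset.mem_range_succ_iff.mp hk), binom_natCast, binom_natCast, Int.cast_mul]

lemma sum_Icc_binom_mul_binom (a b : ℤ) {m j : ℕ} (hmj : m ≤ j) (l : ℕ) :
    ∑ k ∈ Finset.Icc m l, binom a (k - j) * binom b (l - k) = binom (a + b) (l - j) := by
  rcases lt_or_ge l j with hl | hl
  · rw [binom_of_neg (by omega)]
    refine Finset.sum_eq_zero fun k hk => ?_
    rw [binom_of_neg (by rw [Finset.mem_Icc] at hk; omega), zero_mul]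
  · obtain ⟨d, rfl⟩ := Nat.exists_eq_add_of_le hl
    rw [← Finset.sum_subset (Finset.Icc_subset_Icc_left hmj) fun k _ hk => ?_,
      ← Finset.Ico_add_one_right_eq_Icc, Finset.sum_Ico_eq_sum_range]
    · simpa [add_assoc] using sum_range_binom_mul_binom a b d
    · rw [binom_of_neg (by simp_all), zero_mul]

/-! ### Determinants -/

section Determinants

variable {ι κ R : Type*} [Fintype ι] [DecidableEq ι] [CommRing R]

lemma det_add_eq_sum_det_piecewise (M M' : Matrix ι ι R) :
    (M + M').det =
      ∑ s : Finset ι, (Matrix.of fun i j => if j ∈ s then M i j else M' i j).det := by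
  rw [← Matrix.det_transpose]
  refine (Matrix.detRowAlternating.toMultilinearMap.map_add_univ M.transpose M'.transpose).trans
    (Finset.sum_congr rfl fun s _ => ?_)
  rw [← Matrix.det_transpose]
  refine congrArg Matrix.det (Matrix.ext fun j i => ?_)
  by_cases hj : j ∈ s <;> simp [Finset.piecewise, hj]

lemma det_one_sub_eq_one {α : Type*} [LinearOrder α] (τ : ι → α) {P : Matrix ι ι R}
    (hP : ∀ a b, τ b ≤ τ a → P a b = 0) : (1 - P).det = 1 := by
  have hblock : (1 - P).BlockTriangular τ := fun a b hab => by
    rw [Matrix.sub_apply, hP a b hab.le, Matrix.one_apply_ne (by rintro rfl; exact hab.false),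
      sub_zero]
  rw [hblock.det]
  refine Finset.prod_eq_one fun k _ => ?_
  rw [← Matrix.det_one (n := {a // τ a = k})]
  refine congrArg Matrix.det (Matrix.ext fun a b => ?_)
  simp [Matrix.toSquareBlock_def, hP a b (b.2.trans a.2.symm).le, Matrix.one_apply,
    Subtype.ext_iff]

lemma det_add_mul_eq_det_mul_det_one_add [Fintype κ] [DecidableEq κ] {A W : Matrix κ κ R}
    {B : Matrix ι κ R} {C Φ : Matrix ι ι R} {U H : Matrix κ ι R} (hAW : A * W = 1)
    (hU : U = H + U * C * Φ) (hΦ : (1 - C * Φ).det = 1) :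
    (A + U * C * B).det = A.det * (1 + C * (-Φ + B * W * H)).det := by
  have hfactor : A + U * C * B = A * (1 + W * U * (C * B)) := by
    simp only [mul_add, mul_one, ← Matrix.mul_assoc, hAW, Matrix.one_mul]
  have hkernel : (1 + C * B * (W * U)) * (1 - C * Φ) = 1 + C * (-Φ + B * W * H) := by
    rw [eq_sub_of_add_eq hU.symm]
    simp only [add_mul, mul_add, mul_sub, Matrix.mul_sub, Matrix.mul_neg, one_mul, mul_one,
      Matrix.mul_assoc]
    abel
  rw [hfactor, Matrix.det_mul, Matrix.det_one_add_mul_comm, ← hkernel, Matrix.det_mul, hΦ, mul_one]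

lemma prod_indicator_eq_sum_prod_one_add (E : ι → Prop) [DecidablePred E] :
    ∏ a, (if E a then (1 : R) else 0) = ∑ s : Finset ι, (∏ a, if a ∈ s then 1 else -1) *
      ∏ a, (1 + if E a then if a ∈ s then 1 else 0 else 0) := by
  calc ∏ a, (if E a then (1 : R) else 0) = ∏ a, ((1 + if E a then (1 : R) else 0) + -1) := by simp
    _ = _ := by
      rw [Finset.prod_add, Finset.powerset_univ]
      refine Finset.sum_congr rfl fun s _ => ?_
      rw [← Finset.prod_mul_distrib, ← Finset.prod_mul_prod_compl s, Finset.compl_eq_univ_sdiff]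
      congr 1
      · exact Finset.prod_congr rfl fun a ha => by simp [ha]
      · refine Finset.prod_congr rfl fun a ha => ?_
        simp [(Finset.mem_sdiff.mp ha).2]

lemma det_eq_sum_det_one_add (K : Matrix ι ι R) :
    K.det = ∑ s : Finset ι, (∏ a, if a ∈ s then 1 else -1) *
      (1 + Matrix.diagonal (fun a => if a ∈ s then 1 else 0) * K).det := by
  rw [show K = (1 + K) + (-1) by abel, det_add_eq_sum_det_piecewise]
  refine Finset.sum_congr rfl fun s _ => ?_
  rw [Matrix.det_one_add_mul_comm, ← Matrix.det_diagonal, mul_comm, ← Matrix.det_mul]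
  refine congrArg Matrix.det (Matrix.ext fun i j => ?_)
  by_cases hj : j ∈ s <;> simp [hj, Matrix.one_apply]

lemma card_filter_forall_eq_mul_det {Ω : Type*} {S : Finset Ω} {E : ι → Ω → Prop}
    [∀ a, DecidablePred (E a)] {D : R} {K : Matrix ι ι R}
    (h : ∀ c : ι → R, ∑ w ∈ S, ∏ a, (1 + if E a w then c a else 0) =
      D * (1 + Matrix.diagonal c * K).det) :
    ((S.filter fun w => ∀ a, E a w).card : R) = D * K.det := by
  calc ((S.filter fun w => ∀ a, E a w).card : R) = ∑ w ∈ S, ∏ a, if E a w then 1 else 0 := by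
        simp [Finset.prod_ite_zero]
    _ = ∑ s : Finset ι, (∏ a, if a ∈ s then 1 else -1) *
          ∑ w ∈ S, ∏ a, (1 + if E a w then if a ∈ s then 1 else 0 else 0) := by
        simp only [prod_indicator_eq_sum_prod_one_add, Finset.mul_sum]
        exact Finset.sum_comm
    _ = D * K.det := by
        simp only [h, det_eq_sum_det_one_add K, Finset.mul_sum, mul_left_comm D]

end Determinants

lemma uniformProb_image {Ω Ω' : Type*} {f : Ω → Ω'} {S E : Set Ω} {E' : Set Ω'}
    (hf : Set.InjOn f S) (h : ∀ ω ∈ S, f ω ∈ E' ↔ ω ∈ E) :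
    uniformProb (f '' S) E' = uniformProb S E := by
  have hinter : f '' S ∩ E' = f '' (S ∩ E) := by
    rw [← Set.image_inter_preimage]
    congr 1
    ext ω
    exact and_congr_right (h ω)
  rw [uniformProb, uniformProb, hinter, hf.ncard_image,
    (hf.mono Set.inter_subset_left).ncard_image]

lemma uniformProb_eq_det {Ω ι : Type*} [Fintype ι] [DecidableEq ι] {S : Set Ω} (hS : S.Finite)
    (hne : S.Nonempty) {E : ι → Ω → Prop} [∀ a, DecidablePred (E a)] {D : ℚ} {K : Matrix ι ι ℚ}
    (h : ∀ c : ι → ℚ, ∑ᶠ w ∈ S, ∏ a, (1 + if E a w then c a else 0) =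
      D * (1 + Matrix.diagonal c * K).det) :
    uniformProb S {w | ∀ a, E a w} = K.det := by
  simp only [finsum_mem_eq_finite_toFinset_sum _ hS] at h
  have hcard : (S.ncard : ℚ) = D := by
    simpa [Set.ncard_eq_toFinset_card S hS, Matrix.diagonal_zero] using h 0
  have hinter : S ∩ {w | ∀ a, E a w} = (hS.toFinset.filter fun w => ∀ a, E a w : Finset Ω) := by
    ext w; simp
  have hpos : 0 < S.ncard := (Set.ncard_pos hS).mpr hne
  rw [uniformProb, hinter, Set.ncard_coe_finset, card_filter_forall_eq_mul_det h, ← hcard,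
    mul_div_cancel_left₀ _ (by positivity)]

section PointWeights

variable {α ι κ R : Type*} [Fintype ι] [Fintype κ] [CommSemiring R]

lemma one_add_sum_ite_eq_prod {P : ι → Prop} [DecidablePred P] (hP : ∀ a b, P a → P b → a = b)
    (c : ι → R) : 1 + ∑ a, (if P a then c a else 0) = ∏ a, (1 + if P a then c a else 0) := by
  by_cases h : ∃ a, P a
  · obtain ⟨a, ha⟩ := h
    have hne : ∀ b ≠ a, ¬ P b := fun b hb h => hb (hP b a h ha)
    rw [Finset.sum_eq_single a (fun b _ hb => if_neg (hne b hb)) (by simp),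
      Finset.prod_eq_single a (fun b _ hb => by rw [if_neg (hne b hb), add_zero]) (by simp)]
  · push Not at h
    simp [h]

lemma prod_one_add_sum_ite [DecidableEq α] {p : ι → α} (hp : Function.Injective p) {g : κ → α}
    (hg : Function.Injective g) [∀ a, Decidable (∃ k, p a = g k)] (c : ι → R) :
    ∏ k, (1 + ∑ a, if p a = g k then c a else 0) =
      ∏ a, (1 + if ∃ k, p a = g k then c a else 0) := by
  have hvisits : ∀ a, 1 + (if ∃ k, p a = g k then c a else 0) =
      ∏ k, (1 + if p a = g k then c a else 0) := fun a => by
    rw [← one_add_sum_ite_eq_prod fun k l hk hl => hg (hk.symm.trans hl)]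
    congr 1
    split_ifs with h
    · obtain ⟨k, hk⟩ := h
      rw [Finset.sum_eq_single k (fun l _ hl => if_neg fun h => hl (hg (h.symm.trans hk)))
        (by simp), if_pos hk]
    · exact (Finset.sum_eq_zero fun k _ => if_neg fun hk => h ⟨k, hk⟩).symm
  simp only [hvisits]
  rw [Finset.prod_comm]
  exact Finset.prod_congr rfl fun k _ =>
    one_add_sum_ite_eq_prod (fun a b ha hb => hp (ha.trans hb.symm)) c

end PointWeights

/-! ### Weighted enumeration of walks -/

section Walks

variable {R : Type*} {n N : ℕ} {y : Fin n → ℤ}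

lemma strictMono_of_walks_nonempty (hne : (walks n N y).Nonempty) : StrictMono y := by
  obtain ⟨w, hmono, -, hlast, -⟩ := hne
  exact funext hlast ▸ hmono (Fin.last N)

lemma walks_bounds {w : Fin (N + 1) → Fin n → ℤ} (hw : w ∈ walks n N y) (t : Fin (N + 1))
    (i : Fin n) : w t i ∈ Set.Icc ((i : ℤ) + 1) ((i : ℤ) + 1 + t) := by
  obtain ⟨-, hstart, -, hstep⟩ := hw
  induction t using Fin.induction with
  | zero => simp [hstart]
  | succ t ih =>
    simp only [Fin.val_castSucc, Fin.val_succ, Set.mem_Icc] at ih ⊢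
    rcases hstep t i with h | h <;> omega

lemma bounds_of_walks_nonempty (hne : (walks n N y).Nonempty) (i : Fin n) :
    y i ∈ Set.Icc 1 ((N : ℤ) + n) := by
  obtain ⟨w, hw⟩ := hne
  have h := walks_bounds hw (Fin.last N) i
  rw [hw.2.2.1] at h
  simp only [Fin.val_last, Set.mem_Icc] at h ⊢
  omega

theorem walks_finite (n N : ℕ) (y : Fin n → ℤ) : (walks n N y).Finite :=
  (Set.Finite.pi' fun _ => Set.Finite.pi' fun _ => Set.finite_Icc _ _).subset
    fun _ hw => walks_bounds hw

lemma walks_zero (hy : StrictMono y) :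
    walks n 0 y = {w | (∀ i, y i = (i : ℤ) + 1) ∧ w = fun _ => y} := by
  ext w
  constructor
  · rintro ⟨-, hstart, hlast, -⟩
    refine ⟨fun i => (hlast i).symm.trans (hstart i), funext fun t => ?_⟩
    rw [show t = Fin.last 0 from Fin.ext (by omega)]
    exact funext hlast
  · rintro ⟨h, rfl⟩
    exact ⟨fun _ => hy, h, fun _ => rfl, fun t => t.elim0⟩

/-- The positions one step before `y` if precisely the walkers outside `s` move in this step. -/
def stepBack (y : Fin n → ℤ) (s : Finset (Fin n)) (i : Fin n) : ℤ :=
  if i ∈ s then y i else y i - 1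

lemma stepBack_injective (y : Fin n → ℤ) : Function.Injective (stepBack y) := by
  intro s s' h
  ext i
  have hi := congrFun h i
  by_cases h1 : i ∈ s <;> by_cases h2 : i ∈ s' <;>
    simp [stepBack, h1, h2] at hi ⊢
  omega

lemma stepBack_monotone (hy : StrictMono y) (s : Finset (Fin n)) : Monotone (stepBack y s) := by
  refine monotone_iff_forall_lt.mpr fun i j hij => ?_
  have := hy hij
  unfold stepBack
  split_ifs <;> omega

lemma walks_succ (hy : StrictMono y) :
    walks n (N + 1) y = ⋃ s, (Fin.snoc · y) '' walks n N (stepBack y s) := by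
  ext w
  simp only [Set.mem_iUnion, Set.mem_image]
  constructor
  · rintro ⟨hmono, hstart, hlast, hstep⟩
    refine ⟨Finset.univ.filter fun i => w (Fin.last N).castSucc i = y i, Fin.init w,
      ⟨fun t => hmono _, hstart, fun i => ?_, fun t => hstep t.castSucc⟩, ?_⟩
    · have h := hstep (Fin.last N) i
      rw [Fin.succ_last, hlast] at h
      simp only [Fin.init, stepBack, Finset.mem_filter_univ]
      split_ifs <;> omega
    · rw [← funext hlast]
      exact Fin.snoc_init_self w
  · rintro ⟨s, v, ⟨hmono, hstart, hlast, hstep⟩, rfl⟩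
    refine ⟨fun t => ?_, fun i => ?_, fun i => by simp, fun t i => ?_⟩
    · cases t using Fin.lastCases with
      | last => simpa using hy
      | cast t => simpa using hmono t
    · rw [← Fin.castSucc_zero, Fin.snoc_castSucc]
      exact hstart i
    · cases t using Fin.lastCases with
      | last =>
        rw [Fin.succ_last, Fin.snoc_last, Fin.snoc_castSucc, hlast, stepBack]
        split_ifs <;> simp
      | cast t =>
        rw [← Fin.castSucc_succ, Fin.snoc_castSucc, Fin.snoc_castSucc]
        exact hstep t i

/-- The product of the weights `f t x` of all visits of the walkers `w` to sites `x` at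
times `t`. -/
def walkWeight [CommMonoid R] (f : ℕ → ℤ → R) (w : Fin (N + 1) → Fin n → ℤ) : R :=
  ∏ t : Fin (N + 1), ∏ i, f t (w t i)

lemma walkWeight_snoc [CommMonoid R] (f : ℕ → ℤ → R) (w : Fin (N + 1) → Fin n → ℤ)
    (y : Fin n → ℤ) :
    walkWeight f (Fin.snoc w y : Fin (N + 2) → Fin n → ℤ) =
      (∏ i, f (N + 1) (y i)) * walkWeight f w := by
  simp [walkWeight, Fin.prod_univ_castSucc (n := N + 1), mul_comm]

lemma finsum_walkWeight_succ [CommSemiring R] (f : ℕ → ℤ → R) (N : ℕ) (hy : StrictMono y) :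
    ∑ᶠ w ∈ walks n (N + 1) y, walkWeight f w =
      (∏ i, f (N + 1) (y i)) * ∑ s, ∑ᶠ w ∈ walks n N (stepBack y s), walkWeight f w := by
  have hsnoc : Function.Injective
      (Fin.snoc · y : (Fin (N + 1) → Fin n → ℤ) → Fin (N + 2) → Fin n → ℤ) :=
    fun w w' h => (Fin.snoc_inj.mp h).1
  have hdisjoint : Pairwise (Function.onFun Disjoint fun s =>
      (Fin.snoc · y : _ → Fin (N + 2) → Fin n → ℤ) '' walks n N (stepBack y s)) := by
    refine fun s s' hne => (Set.disjoint_image_iff hsnoc).mpr (Set.disjoint_left.mpr ?_)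
    exact fun w hw hw' => hne (stepBack_injective y
      ((funext hw.2.2.1).symm.trans (funext hw'.2.2.1)))
  rw [walks_succ hy, finsum_mem_iUnion hdisjoint fun s => (walks_finite _ _ _).image _,
    finsum_eq_sum_of_fintype, Finset.mul_sum]
  refine Finset.sum_congr rfl fun s _ => ?_
  rw [finsum_mem_image hsnoc.injOn, mul_finsum_mem' _ _ (walks_finite _ _ _)]
  simp only [walkWeight_snoc]

/-- The total weight of the paths of a single walker from `j` to `x` in time `t`, where a visit of
the site `u` at time `s < t` has the weight `f s u`. -/
def pathWeight [CommSemiring R] (f : ℕ → ℤ → R) : ℕ → ℤ → ℤ → R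
  | 0, j, x => if x = j then 1 else 0
  | t + 1, j, x => f t x * pathWeight f t j x + f t (x - 1) * pathWeight f t j (x - 1)

/-- The total weights of the paths of a single walker from `i + 1` at time `0` to `y j` at time `N`,
including the weight of the visit of `y j`. -/
def pathWeightMatrix [CommSemiring R] (f : ℕ → ℤ → R) (N : ℕ) (y : Fin n → ℤ) :
    Matrix (Fin n) (Fin n) R :=
  Matrix.of fun i j => f N (y j) * pathWeight f N ((i : ℤ) + 1) (y j)

lemma det_pathWeightMatrix [CommRing R] (f : ℕ → ℤ → R) (N : ℕ) (y : Fin n → ℤ) :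
    (pathWeightMatrix f N y).det =
      (∏ i, f N (y i)) *
        (Matrix.of fun i j : Fin n => pathWeight f N ((i : ℤ) + 1) (y j)).det :=
  Matrix.det_mul_row _ _

lemma det_start [CommRing R] (hy : StrictMono y) :
    (Matrix.of fun i j : Fin n => if y j = (i : ℤ) + 1 then (1 : R) else 0).det =
      if ∀ i, y i = (i : ℤ) + 1 then 1 else 0 := by
  split_ifs with h
  · refine (congrArg Matrix.det (Matrix.ext fun i j => ?_)).trans Matrix.det_one
    simp [h, Matrix.one_apply, Fin.ext_iff, eq_comm]
  · refine (Matrix.det_apply _).trans (Finset.sum_eq_zero fun σ _ => ?_)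
    suffices hσ : ∃ i, y i ≠ (σ i : ℤ) + 1 by
      obtain ⟨i, hi⟩ := hσ
      rw [Finset.prod_eq_zero (Finset.mem_univ i) (by simp [hi]), smul_zero]
    by_contra! hyσ
    have hmono : StrictMono σ := fun i j hij => by
      have := hy hij
      rw [hyσ, hyσ] at this
      exact Fin.lt_def.mpr (by omega)
    have hid : ⇑σ = id :=
      (hmono.range_inj strictMono_id).mp (by rw [σ.surjective.range_eq, Set.range_id])
    exact h fun i => by simpa [hid] using hyσ i

lemma det_pathWeightMatrix_succ [CommRing R] (f : ℕ → ℤ → R) (N : ℕ) (y : Fin n → ℤ) :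
    (pathWeightMatrix f (N + 1) y).det =
      (∏ i, f (N + 1) (y i)) * ∑ s, (pathWeightMatrix f N (stepBack y s)).det := by
  have hstep : (Matrix.of fun i j : Fin n => pathWeight f (N + 1) ((i : ℤ) + 1) (y j)) =
      pathWeightMatrix f N y + pathWeightMatrix f N (y · - 1) := rfl
  have hpiecewise : ∀ s, (Matrix.of fun i j =>
      if j ∈ s then pathWeightMatrix f N y i j else pathWeightMatrix f N (y · - 1) i j) =
        pathWeightMatrix f N (stepBack y s) := fun s => Matrix.ext fun i j => by
    by_cases hj : j ∈ s <;> simp [pathWeightMatrix, stepBack, hj]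
  simp only [← hpiecewise, ← det_add_eq_sum_det_piecewise, ← hstep, det_pathWeightMatrix]

/-- Walkers that would meet in the last step contribute a determinant with two equal columns, so no
involution on intersecting paths is needed. -/
theorem finsum_walkWeight_eq_det [CommRing R] (f : ℕ → ℤ → R) (N : ℕ) (hy : StrictMono y) :
    ∑ᶠ w ∈ walks n N y, walkWeight f w = (pathWeightMatrix f N y).det := by
  induction N generalizing y with
  | zero =>
    simp only [det_pathWeightMatrix, pathWeight]
    rw [det_start hy, walks_zero hy]
    split_ifs with h <;> simp [h, walkWeight]
  | succ N ih =>
    rw [finsum_walkWeight_succ f N hy, det_pathWeightMatrix_succ]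
    congr 1
    refine Finset.sum_congr rfl fun s _ => ?_
    by_cases hs : StrictMono (stepBack y s)
    · exact ih hs
    · obtain ⟨i, j, hij, hne⟩ := Function.not_injective_iff.mp fun hinj =>
        hs ((stepBack_monotone hy s).strictMono_of_injective hinj)
      rw [Set.not_nonempty_iff_eq_empty.mp (mt strictMono_of_walks_nonempty hs), finsum_mem_empty,
        Matrix.det_zero_of_column_eq hne fun k => by simp [pathWeightMatrix, hij]]

end Walks

/-! ### Correlation functions of walks -/

section Correlations

variable {ι : Type*} [Fintype ι] {n N : ℕ} {y : Fin n → ℤ}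

lemma phi_add_ite (r t x z : ℤ) :
    phi r t x z + (if r = t ∧ x = z then 1 else 0) =
      if r ≤ t then binom (t - r) (z - x) else 0 := by
  rcases lt_trichotomy r t with h | rfl | h
  · simp [phi, h, h.ne, h.le]
  · simp [phi, binom_zero_left, sub_eq_zero, eq_comm]
  · simp [phi, h.not_gt, h.ne', h.not_ge]

lemma phi_add_one (r t x z : ℤ) :
    phi r (t + 1) x z = (phi r t x z + if r = t ∧ x = z then 1 else 0) +
      (phi r t x (z - 1) + if r = t ∧ x = z - 1 then 1 else 0) := by
  rw [phi_add_ite, phi_add_ite, phi]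
  by_cases h : r ≤ t
  · rw [if_pos (by omega), if_pos h, if_pos h, add_sub_right_comm, binom_add_one,
      sub_right_comm z 1 x]
  · rw [if_neg (by omega), if_neg h, if_neg h, add_zero]

/-- The weight `1 + c a` at the space-time points `(τ a, ξ a)`, and `1` elsewhere; as a function of
`c`, the corresponding total weight of the walks generates the numbers of walks that visit given
sets of these points. -/
def pointWeight (τ : ι → ℕ) (ξ : ι → ℤ) (c : ι → ℚ) (t : ℕ) (x : ℤ) : ℚ :=
  1 + ∑ a, if τ a = t ∧ ξ a = x then c a else 0

lemma pointWeight_mul (τ : ι → ℕ) (ξ : ι → ℤ) (c : ι → ℚ) (g : ℕ → ℤ → ℚ) (t : ℕ) (x : ℤ) :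
    pointWeight τ ξ c t x * g t x =
      g t x + ∑ a, (if (τ a : ℤ) = t ∧ ξ a = x then 1 else 0) * (c a * g (τ a) (ξ a)) := by
  rw [pointWeight, add_mul, one_mul, Finset.sum_mul]
  congr 1
  refine Finset.sum_congr rfl fun a _ => ?_
  by_cases h : τ a = t ∧ ξ a = x
  · simp [h]
  · rw [if_neg h, if_neg (by exact_mod_cast h), zero_mul, zero_mul]

/-- The sum runs over the last marked point before time `t` on a path, where the path is split. -/
lemma pathWeight_pointWeight (τ : ι → ℕ) (ξ : ι → ℤ) (c : ι → ℚ) (t : ℕ) (j x : ℤ) :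
    pathWeight (pointWeight τ ξ c) t j x = binom t (x - j) +
      ∑ a, phi (τ a) t (ξ a) x * (c a * pathWeight (pointWeight τ ξ c) (τ a) j (ξ a)) := by
  induction t generalizing x with
  | zero =>
    have hphi : ∀ a, phi (τ a) 0 (ξ a) x = 0 := fun a => if_neg (by omega)
    simp [hphi, pathWeight, binom_zero_left, sub_eq_zero]
  | succ t ih =>
    have hmul := pointWeight_mul τ ξ c (pathWeight (pointWeight τ ξ c) · j ·) t
    simp only [pathWeight, hmul]
    rw [ih x, ih (x - 1), Nat.cast_succ, binom_add_one, sub_right_comm x 1 j]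
    simp only [phi_add_one, add_mul, Finset.sum_add_distrib]
    ring

/-- The matrix of the numbers of paths of a single walker from `j + 1` to `y i` in time `N`. -/
noncomputable def pathMatrix (N : ℕ) (y : Fin n → ℤ) : Matrix (Fin n) (Fin n) ℚ :=
  Matrix.of fun j i => binom N (y i - ((j : ℤ) + 1))

lemma pathWeightMatrix_pointWeight [DecidableEq ι] (y : Fin n → ℤ) {τ : ι → ℕ} (hτ : ∀ a, τ a ≤ N)
    (ξ : ι → ℤ) (c : ι → ℚ) :
    pathWeightMatrix (pointWeight τ ξ c) N y = pathMatrix N y +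
      (Matrix.of fun (j : Fin n) a => pathWeight (pointWeight τ ξ c) (τ a) ((j : ℤ) + 1) (ξ a)) *
        Matrix.diagonal c * Matrix.of fun a i => binom (N - τ a) (y i - ξ a) := by
  ext j i
  have hmul := pointWeight_mul τ ξ c (pathWeight (pointWeight τ ξ c) · ((j : ℤ) + 1) ·) N (y i)
  simp only [pathWeightMatrix, Matrix.of_apply, hmul]
  rw [pathWeight_pointWeight, add_assoc, ← Finset.sum_add_distrib]
  simp only [← add_mul, phi_add_ite, Matrix.add_apply, Matrix.mul_apply (N := Matrix.of _),
    Matrix.mul_diagonal, Matrix.of_apply, pathMatrix]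
  congr 1
  refine Finset.sum_congr rfl fun a _ => ?_
  rw [if_pos (by exact_mod_cast hτ a)]
  ring

/-- The Eynard-Mehta kernel of the points `(τ a, ξ a)`, for an inverse `W` of the path matrix. -/
noncomputable def eynardMehtaKernel (N : ℕ) (y : Fin n → ℤ) (W : Matrix (Fin n) (Fin n) ℚ)
    (τ : ι → ℕ) (ξ : ι → ℤ) : Matrix ι ι ℚ :=
  -(Matrix.of fun a b => phi (τ a) (τ b) (ξ a) (ξ b)) +
    (Matrix.of fun a i => binom (N - τ a) (y i - ξ a)) * W *
      Matrix.of fun (j : Fin n) b => binom (τ b) (ξ b - ((j : ℤ) + 1))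

lemma det_pathWeightMatrix_pointWeight [DecidableEq ι] {W : Matrix (Fin n) (Fin n) ℚ}
    (hW : pathMatrix N y * W = 1) {τ : ι → ℕ} (hτ : ∀ a, τ a ≤ N) (ξ : ι → ℤ) (c : ι → ℚ) :
    (pathWeightMatrix (pointWeight τ ξ c) N y).det =
      (pathMatrix N y).det * (1 + Matrix.diagonal c * eynardMehtaKernel N y W τ ξ).det := by
  rw [pathWeightMatrix_pointWeight y hτ]
  refine det_add_mul_eq_det_mul_det_one_add hW ?_ (det_one_sub_eq_one τ fun a b hab => ?_)
  · ext j b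
    simp only [Matrix.add_apply, Matrix.mul_apply (N := Matrix.of _), Matrix.mul_diagonal,
      Matrix.of_apply]
    rw [pathWeight_pointWeight]
    congr 1
    exact Finset.sum_congr rfl fun a _ => by ring
  · rw [Matrix.diagonal_mul, Matrix.of_apply, phi, if_neg (by omega), mul_zero]

lemma walkWeight_pointWeight {w : Fin (N + 1) → Fin n → ℤ} (hw : ∀ t, Function.Injective (w t))
    {t : ι → Fin (N + 1)} {x : ι → ℤ} (htx : Function.Injective fun a => (t a, x a)) (c : ι → ℚ)
    [∀ a, Decidable (∃ i, w (t a) i = x a)] :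
    walkWeight (pointWeight (fun a => (t a : ℕ)) x c) w =
      ∏ a, (1 + if ∃ i, w (t a) i = x a then c a else 0) := by
  classical
  have hvisits : ∀ a, (∃ i, w (t a) i = x a) ↔
      ∃ k : Fin (N + 1) × Fin n, (t a, x a) = (k.1, w k.1 k.2) := fun a => by
    simp [eq_comm]
  have hinj : Function.Injective fun k : Fin (N + 1) × Fin n => (k.1, w k.1 k.2) := by
    rintro ⟨s, i⟩ ⟨s', i'⟩ h
    obtain ⟨rfl, hi⟩ : s = s' ∧ w s i = w s' i' := Prod.mk.inj h
    rw [hw s hi]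
  refine Eq.trans ?_ ((prod_one_add_sum_ite htx hinj c).trans ?_)
  · simp only [walkWeight, pointWeight, Fintype.prod_prod_type, Prod.mk.injEq, Fin.ext_iff]
  · simp only [hvisits]

theorem uniformProb_walks_eq_det_eynardMehtaKernel [DecidableEq ι] (hne : (walks n N y).Nonempty)
    {W : Matrix (Fin n) (Fin n) ℚ} (hW : pathMatrix N y * W = 1) {t : ι → Fin (N + 1)} {x : ι → ℤ}
    (htx : Function.Injective fun a => (t a, x a)) :
    uniformProb (walks n N y) {w | ∀ a, ∃ i, w (t a) i = x a} =
      (eynardMehtaKernel N y W (fun a => (t a : ℕ)) x).det := by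
  classical
  refine uniformProb_eq_det (walks_finite n N y) hne (D := (pathMatrix N y).det) fun c => ?_
  rw [← det_pathWeightMatrix_pointWeight hW fun a => Nat.le_of_lt_succ (t a).2,
    ← finsum_walkWeight_eq_det _ _ (strictMono_of_walks_nonempty hne)]
  exact finsum_mem_congr rfl fun w hw =>
    (walkWeight_pointWeight (fun s => (hw.1 s).injective) htx c).symm

end Correlations

/-! ### The inverse of the path matrix -/

section Inverse

open Polynomial

lemma sum_eval_mul_prod_erase {F ι : Type*} [Field F] [DecidableEq ι] {s : Finset ι} {v : ι → F}
    (hv : Set.InjOn v s) {f : F[X]} (hf : f.degree < s.card) (u : F) :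
    ∑ i ∈ s, f.eval (v i) * ∏ l ∈ s.erase i, (u - v l) / (v i - v l) = f.eval u := by
  conv_rhs => rw [Lagrange.eq_interpolate hv hf]
  simp [Lagrange.interpolate_apply, Polynomial.eval_finsetSum, Lagrange.basis, eval_prod,
    Lagrange.basisDivisor, div_eq_inv_mul]

lemma eval_descPochhammer_add (k p : ℕ) :
    (descPochhammer ℚ k).eval ((k + p : ℕ) : ℚ) = (k + p).factorial / p.factorial := by
  rw [descPochhammer_eval_eq_descFactorial, eq_div_iff (by positivity), mul_comm]
  have h := Nat.factorial_mul_descFactorial (Nat.le_add_right k p)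
  rw [Nat.add_sub_cancel_left] at h
  exact_mod_cast h

lemma eval_descPochhammer_of_lt {k m : ℕ} (h : m < k) :
    (descPochhammer ℚ k).eval (m : ℚ) = 0 := by
  rw [descPochhammer_eval_eq_descFactorial, Nat.descFactorial_of_lt h, Nat.cast_zero]

/-- The polynomial in `v` that takes the values `C(N, v - 1 - j) / C(N + j + b, v - 1)` at the
integers `v` for which the denominator does not vanish. -/
noncomputable def binomRatio (N j b : ℕ) : ℚ[X] :=
  C ((N.factorial : ℚ) / (N + j + b).factorial) * ((descPochhammer ℚ j).comp (X - 1) *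
    (descPochhammer ℚ b).comp (C ((N + j + b + 1 : ℕ) : ℚ) - X))

lemma degree_binomRatio_lt (N j b : ℕ) : (binomRatio N j b).degree < (j + b + 1 : ℕ) := by
  have hX : (X - 1 : ℚ[X]).natDegree ≤ 1 := by compute_degree
  have hCX : (C ((N + j + b + 1 : ℕ) : ℚ) - X : ℚ[X]).natDegree ≤ 1 := by compute_degree
  refine degree_le_natDegree.trans_lt (Nat.cast_lt.mpr (Nat.lt_succ_of_le ?_))
  calc (binomRatio N j b).natDegree
      ≤ j * (X - 1 : ℚ[X]).natDegree + b * (C ((N + j + b + 1 : ℕ) : ℚ) - X : ℚ[X]).natDegree := by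
        refine (natDegree_C_mul_le _ _).trans (natDegree_mul_le.trans ?_)
        simp only [natDegree_comp, descPochhammer_natDegree, le_refl]
    _ ≤ j + b := by gcongr <;> nlinarith

lemma eval_binomRatio_mul_binom (N j b : ℕ) {v : ℤ} (hv : v ∈ Set.Icc 1 ((N : ℤ) + j + b + 1)) :
    (binomRatio N j b).eval (v : ℚ) * binom (N + j + b) (v - 1) = binom N (v - 1 - j) := by
  obtain ⟨u, u', rfl, hu⟩ : ∃ u u' : ℕ, v = u + 1 ∧ u + u' = N + j + b :=
    ⟨(v - 1).toNat, (N + j + b + 1 - v).toNat, by grind, by grind⟩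
  have heval : (binomRatio N j b).eval ((u + 1 : ℤ) : ℚ) = (N.factorial : ℚ) / (u + u').factorial *
      ((descPochhammer ℚ j).eval (u : ℚ) * (descPochhammer ℚ b).eval (u' : ℚ)) := by
    simp [binomRatio, ← hu]
  rw [heval, add_sub_cancel_right, show (N : ℤ) + j + b = (u + u' : ℕ) by omega,
    binom_natCast_natCast]
  rcases lt_or_ge u j with huj | huj
  · rw [eval_descPochhammer_of_lt huj, binom_of_neg (by omega)]
    ring
  obtain ⟨p, rfl⟩ := Nat.exists_eq_add_of_le huj
  rw [show ((j + p : ℕ) : ℤ) - j = p by omega, binom_natCast_natCast]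
  rcases lt_or_ge u' b with hub | hub
  · rw [eval_descPochhammer_of_lt hub, Nat.choose_eq_zero_of_lt (n := N) (by omega)]
    simp
  obtain ⟨q, rfl⟩ := Nat.exists_eq_add_of_le hub
  obtain rfl : N = p + q := by omega
  rw [eval_descPochhammer_add, eval_descPochhammer_add, Nat.cast_add_choose, Nat.cast_add_choose]
  field_simp

variable {n N : ℕ} {y : Fin n → ℤ}

lemma binom_pos {a b : ℤ} (hb : b ∈ Set.Icc 0 a) : 0 < binom a b := by
  obtain ⟨h0, ha⟩ := hb
  lift b to ℕ using h0
  lift a to ℕ using (Int.natCast_nonneg b).trans ha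
  rw [binom_natCast_natCast]
  exact_mod_cast Nat.choose_pos (by exact_mod_cast ha)

lemma sum_pathMatrix_div_binom_mul_prod_erase (hy : Function.Injective y)
    (hyN : ∀ i, y i ∈ Set.Icc 1 ((N : ℤ) + n)) (j : Fin n) {k : ℕ} (hk : k ∈ Finset.Icc 1 n) :
    binom (N + n - 1) ((k : ℤ) - 1) * ∑ i, pathMatrix N y j i / binom (N + n - 1) (y i - 1) *
        ∏ l ∈ Finset.univ.erase i, ((k : ℚ) - y l) / ((y i : ℚ) - y l) =
      binom N ((k : ℤ) - ((j : ℕ) + 1 : ℕ)) := by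
  obtain ⟨b, hb⟩ : ∃ b, n = j + b + 1 := ⟨n - 1 - j, by omega⟩
  have hN : (N : ℤ) + n - 1 = N + (j : ℕ) + b := by omega
  have heval : ∀ i, pathMatrix N y j i / binom (N + n - 1) (y i - 1) =
      (binomRatio N j b).eval (y i : ℚ) := fun i => by
    have hi := hyN i
    have hpos : 0 < binom (N + n - 1) (y i - 1) := binom_pos (by grind)
    rw [div_eq_iff hpos.ne', hN, eval_binomRatio_mul_binom N j b (by grind), pathMatrix,
      Matrix.of_apply]
    congr 1
    ring
  have hdegree : (binomRatio N j b).degree < (Finset.univ : Finset (Fin n)).card := by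
    rw [Finset.card_univ, Fintype.card_fin]
    have h := degree_binomRatio_lt N j b
    rwa [← hb] at h
  simp only [heval]
  rw [sum_eval_mul_prod_erase (fun i _ l _ h => hy (Int.cast_injective h)) hdegree, hN, mul_comm,
    ← Int.cast_natCast k, eval_binomRatio_mul_binom N j b (by grind)]
  congr 1
  push_cast
  ring

/-- The inverse of the path matrix: Lagrange interpolation moves the columns of the path matrix from
the endpoints to the nodes `k = 1, …, n`, where the coefficients `C(N, ·)` are inverted by the
coefficients `C(-N, ·)`. -/
noncomputable def pathMatrixInv (N : ℕ) (y : Fin n → ℤ) : Matrix (Fin n) (Fin n) ℚ :=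
  Matrix.of fun i j => (binom (N + n - 1) (y i - 1))⁻¹ *
    ∑ k ∈ Finset.Icc 1 ((j : ℕ) + 1),
      binom (N + n - 1) ((k : ℤ) - 1) *
        binom (N - 1 + ((j : ℕ) + 1) - k) (((j : ℕ) + 1) - k) *
        (-1) ^ (k + ((j : ℕ) + 1)) *
        ∏ l ∈ Finset.univ.erase i, ((k : ℚ) - y l) / ((y i : ℚ) - y l)

lemma binom_mul_neg_one_pow {k l : ℕ} (hkl : k ≤ l) (a : ℤ) :
    binom (a - 1 + l - k) (l - k) * (-1) ^ (k + l) = binom (-a) (l - k) := by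
  obtain ⟨d, rfl⟩ := Nat.exists_eq_add_of_le hkl
  rw [show ((k + d : ℕ) : ℤ) - k = d by omega, binom_neg, add_sub_assoc,
    show ((k + d : ℕ) : ℤ) - k = d by omega, ← add_assoc, pow_add, ← two_mul, pow_mul]
  simp

theorem pathMatrix_mul_pathMatrixInv (hy : Function.Injective y)
    (hyN : ∀ i, y i ∈ Set.Icc 1 ((N : ℤ) + n)) : pathMatrix N y * pathMatrixInv N y = 1 := by
  ext j j'
  calc (pathMatrix N y * pathMatrixInv N y) j j'
      = ∑ k ∈ Finset.Icc 1 ((j' : ℕ) + 1), binom (-N) (((j' : ℕ) + 1 : ℕ) - k) *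
          (binom (N + n - 1) ((k : ℤ) - 1) *
            ∑ i, pathMatrix N y j i / binom (N + n - 1) (y i - 1) *
              ∏ l ∈ Finset.univ.erase i, ((k : ℚ) - y l) / ((y i : ℚ) - y l)) := by
        simp only [Matrix.mul_apply, pathMatrixInv, Matrix.of_apply, Finset.mul_sum]
        rw [Finset.sum_comm]
        refine Finset.sum_congr rfl fun k hk => Finset.sum_congr rfl fun i _ => ?_
        rw [← binom_mul_neg_one_pow (Finset.mem_Icc.mp hk).2]
        push_cast
        ring
    _ = ∑ k ∈ Finset.Icc 1 ((j' : ℕ) + 1), binom N ((k : ℤ) - ((j : ℕ) + 1 : ℕ)) *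
          binom (-N) (((j' : ℕ) + 1 : ℕ) - k) := by
        refine Finset.sum_congr rfl fun k hk => ?_
        rw [sum_pathMatrix_div_binom_mul_prod_erase hy hyN j
          (Finset.Icc_subset_Icc_right j'.2 hk), mul_comm]
    _ = (1 : Matrix (Fin n) (Fin n) ℚ) j j' := by
        rw [sum_Icc_binom_mul_binom _ _ (Nat.le_add_left 1 j), add_neg_cancel, binom_zero_left,
          Matrix.one_apply]
        exact if_congr (by grind) rfl rfl

lemma eynardMehtaKernel_pathMatrixInv {ι : Type*} (τ : ι → ℕ) (ξ : ι → ℤ) :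
    eynardMehtaKernel N y (pathMatrixInv N y) τ ξ =
      Matrix.of fun a b => walkKernel n N y (τ a) (ξ a) (τ b) (ξ b) := by
  ext a b
  simp only [eynardMehtaKernel, walkKernel, Matrix.add_apply, Matrix.neg_apply, Matrix.of_apply,
    Matrix.mul_apply, Finset.sum_mul]
  rw [Finset.sum_comm]
  congr 1
  refine Finset.sum_congr rfl fun i _ => Finset.sum_congr rfl fun j _ => ?_
  rw [pathMatrixInv, Matrix.of_apply]
  ring

theorem uniformProb_walks_eq_det_walkKernel {ι : Type*} [Fintype ι] [DecidableEq ι]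
    (hne : (walks n N y).Nonempty) {t : ι → Fin (N + 1)} {x : ι → ℤ}
    (htx : Function.Injective fun a => (t a, x a)) :
    uniformProb (walks n N y) {w | ∀ a, ∃ i, w (t a) i = x a} =
      (Matrix.of fun a b => walkKernel n N y (t a : ℕ) (x a) (t b : ℕ) (x b)).det := by
  have hinv := pathMatrix_mul_pathMatrixInv (strictMono_of_walks_nonempty hne).injective
    (bounds_of_walks_nonempty hne)
  rw [uniformProb_walks_eq_det_eynardMehtaKernel hne hinv htx, eynardMehtaKernel_pathMatrixInv]

end Inverse

/-! ### The kernel of the half-hexagon -/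

section NovakKernel

lemma prod_Icc_erase_sub {R : Type*} [CommRing R] (a b : ℕ) :
    ∏ l ∈ (Finset.Icc 1 (a + 1 + b)).erase (a + 1), (((a + 1 : ℕ) : R) - l) =
      (-1) ^ b * (a.factorial * b.factorial) := by
  induction b with
  | zero =>
    rw [add_zero, Finset.Icc_erase_right, Finset.prod_Ico_eq_prod_range, ← Nat.descFactorial_self,
      Nat.descFactorial_eq_prod_range, Nat.cast_prod]
    simp only [pow_zero, one_mul, Nat.factorial_zero, Nat.cast_one, mul_one, Nat.add_sub_cancel]
    refine Finset.prod_congr rfl fun l hl => ?_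
    rw [Nat.cast_sub (Finset.mem_range.mp hl).le]
    push_cast
    ring
  | succ b ih =>
    rw [← add_assoc, ← Finset.insert_Icc_right_eq_Icc_add_one (by omega),
      Finset.erase_insert_of_ne (by omega), Finset.prod_insert (by simp), ih, Nat.factorial_succ]
    push_cast
    ring

lemma Icc_one_eq_map (n : ℕ) :
    Finset.Icc 1 n =
      Finset.univ.map (Fin.valEmbedding.trans (addRightEmbedding 1) : Fin n ↪ ℕ) := by
  rw [← Finset.map_map, Fin.map_valEmbedding_univ, Nat.Iio_eq_range, Finset.range_eq_Ico,
    Finset.map_add_right_Ico]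
  rfl

lemma sum_Icc_one_eq_sum_fin {M : Type*} [AddCommMonoid M] (n : ℕ) (f : ℕ → M) :
    ∑ i ∈ Finset.Icc 1 n, f i = ∑ i : Fin n, f (i + 1) := by
  rw [Icc_one_eq_map, Finset.sum_map]
  rfl

lemma prod_Icc_one_erase_eq_prod_fin_erase {M : Type*} [CommMonoid M] {n : ℕ} (i : Fin n)
    (f : ℕ → M) :
    ∏ l ∈ (Finset.Icc 1 n).erase (i + 1), f l = ∏ l ∈ Finset.univ.erase i, f (l + 1) := by
  rw [Icc_one_eq_map, show (i : ℕ) + 1 = Fin.valEmbedding.trans (addRightEmbedding 1) i from rfl,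
    ← Finset.map_erase, Finset.prod_map]
  rfl

lemma prod_fin_erase_two_mul_sub_two_mul {n : ℕ} (i : Fin n) :
    ∏ l ∈ Finset.univ.erase i, (2 * ((i : ℕ) + 1 : ℚ) - 2 * ((l : ℕ) + 1)) =
      (-1) ^ (i + 1 + n) *
        (2 ^ (n - 1) * (i : ℕ).factorial * (n - (i + 1)).factorial) := by
  obtain ⟨b, hb⟩ := Nat.exists_eq_add_of_le i.2
  have h := prod_Icc_erase_sub (R := ℚ) i b
  rw [← Nat.succ_eq_add_one, ← hb, Nat.succ_eq_add_one, prod_Icc_one_erase_eq_prod_fin_erase] at h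
  push_cast at h
  simp only [← mul_sub, Finset.prod_mul_distrib, h, Finset.prod_const,
    Finset.card_erase_of_mem (Finset.mem_univ i), Finset.card_univ, Fintype.card_fin]
  rw [show (i : ℕ) + 1 + n = 2 * (i + 1) + b by omega, pow_add, pow_mul,
    show n - ((i : ℕ) + 1) = b by omega]
  ring

theorem novakKernel_eq_walkKernel (n : ℕ) (r x s z : ℤ) :
    novakKernel n r x s z = walkKernel n (n + 1) (fun i => 2 * ((i : ℕ) + 1)) r x s z := by
  rw [novakKernel, walkKernel, sum_Icc_one_eq_sum_fin]
  congr 1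
  refine Finset.sum_congr rfl fun i _ => ?_
  rw [sum_Icc_one_eq_sum_fin]
  refine Finset.sum_congr rfl fun j _ => ?_
  rw [show ((n + 1 : ℕ) : ℤ) + n - 1 = 2 * n by push_cast; ring]
  push_cast
  congr 1
  refine Finset.sum_congr rfl fun k _ => ?_
  rw [Finset.prod_div_distrib, prod_fin_erase_two_mul_sub_two_mul, add_sub_cancel_right,
    prod_Icc_one_erase_eq_prod_fin_erase, show k + ((j : ℕ) + 1) + (i + 1) + n =
      k + (j + 1) + (i + 1 + n) by ring, pow_add _ (k + _)]
  push_cast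
  rcases neg_one_pow_eq_or ℚ ((i : ℕ) + 1 + n) with h | h <;> rw [h] <;> field_simp

end NovakKernel

/-! ### Walkers of a lozenge tiling -/

section Lozenge

/-- The two triangles `opensRight t x` and `opensLeft t' x'`. Every lozenge is of this form, as two
triangles with a common side open to opposite sides. -/
def trianglePair (t x t' x' : ℤ) : Set Tri := {.opensRight t x, .opensLeft t' x'}

/-- The triangles `opensRight t x` and `opensLeft t' x'` share a side: the vertical one, or one of
the two other sides of `opensRight t x`. -/
def ShareSide (t x t' x' : ℤ) : Prop := (t' = t ∧ x' = x) ∨ (t' = t + 1 ∧ (x' = x ∨ x' = x + 1))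

variable {n : ℕ} {t x t' x' s y : ℤ}

lemma opensRight_mem_trianglePair :
    Tri.opensRight s y ∈ trianglePair t x t' x' ↔ s = t ∧ y = x := by
  simp [trianglePair]

lemma opensLeft_mem_trianglePair :
    Tri.opensLeft s y ∈ trianglePair t x t' x' ↔ s = t' ∧ y = x' := by
  simp [trianglePair]

lemma trianglePair_inj {s' y' : ℤ} :
    trianglePair t x t' x' = trianglePair s y s' y' ↔ (t = s ∧ x = y) ∧ t' = s' ∧ x' = y' := by
  constructor
  · intro h
    rw [← opensRight_mem_trianglePair, ← opensLeft_mem_trianglePair, ← h]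
    simp [trianglePair]
  · rintro ⟨⟨rfl, rfl⟩, rfl, rfl⟩
    rfl

lemma trianglePair_subset {R : Set Tri} :
    trianglePair t x t' x' ⊆ R ↔ Tri.opensRight t x ∈ R ∧ Tri.opensLeft t' x' ∈ R :=
  Set.pair_subset_iff

lemma exists_mem_vertices_of_card_eq_two {a b : Tri} (h : (a.vertices ∩ b.vertices).card = 2) :
    ∃ p₁ p₂ q₁ q₂ : ℤ, ¬ (p₁ = q₁ ∧ p₂ = q₂) ∧ (p₁, p₂) ∈ a.vertices ∧ (p₁, p₂) ∈ b.vertices ∧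
      (q₁, q₂) ∈ a.vertices ∧ (q₁, q₂) ∈ b.vertices := by
  obtain ⟨⟨p₁, p₂⟩, hp, ⟨q₁, q₂⟩, hq, hne⟩ := Finset.one_lt_card.mp (h ▸ one_lt_two)
  rw [Finset.mem_inter] at hp hq
  exact ⟨p₁, p₂, q₁, q₂, by simpa using hne, hp.1, hp.2, hq.1, hq.2⟩

lemma card_inter_vertices_opensRight_ne_two (h : ¬ (t = s ∧ x = y)) :
    ((Tri.opensRight t x).vertices ∩ (Tri.opensRight s y).vertices).card ≠ 2 := by
  intro hc
  obtain ⟨p₁, p₂, q₁, q₂, hne, h1, h2, h3, h4⟩ := exists_mem_vertices_of_card_eq_two hc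
  simp only [Tri.vertices, Finset.mem_insert, Finset.mem_singleton, Prod.mk.injEq] at h1 h2 h3 h4
  omega

lemma card_inter_vertices_opensLeft_ne_two (h : ¬ (t = s ∧ x = y)) :
    ((Tri.opensLeft t x).vertices ∩ (Tri.opensLeft s y).vertices).card ≠ 2 := by
  intro hc
  obtain ⟨p₁, p₂, q₁, q₂, hne, h1, h2, h3, h4⟩ := exists_mem_vertices_of_card_eq_two hc
  simp only [Tri.vertices, Finset.mem_insert, Finset.mem_singleton, Prod.mk.injEq] at h1 h2 h3 h4
  omega

lemma card_inter_vertices_eq_two_iff :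
    ((Tri.opensRight t x).vertices ∩ (Tri.opensLeft t' x').vertices).card = 2 ↔
      ShareSide t x t' x' := by
  constructor
  · intro h
    obtain ⟨p₁, p₂, q₁, q₂, hne, h1, h2, h3, h4⟩ := exists_mem_vertices_of_card_eq_two h
    simp only [Tri.vertices, Finset.mem_insert, Finset.mem_singleton, Prod.mk.injEq] at h1 h2 h3 h4
    unfold ShareSide
    omega
  · rw [Finset.card_eq_two]
    rintro (⟨rfl, rfl⟩ | ⟨rfl, rfl | rfl⟩)
    on_goal 1 => refine ⟨(t', x'), (t', x' + 1), by simp, ?_⟩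
    on_goal 2 => refine ⟨(t, x'), (t + 1, x' + 1), by simp, ?_⟩
    on_goal 3 => refine ⟨(t, x + 1), (t + 1, x + 1), by simp, ?_⟩
    all_goals
      ext ⟨p, q⟩
      simp only [Tri.vertices, Finset.mem_inter, Finset.mem_insert, Finset.mem_singleton,
        Prod.mk.injEq]
      omega

lemma isLozenge_iff {q : Set Tri} :
    IsLozenge q ↔ ∃ t x t' x', ShareSide t x t' x' ∧ q = trianglePair t x t' x' := by
  constructor
  · rintro ⟨⟨t, x⟩ | ⟨t, x⟩, ⟨s, y⟩ | ⟨s, y⟩, hne, hc, rfl⟩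
    · exact absurd hc (card_inter_vertices_opensRight_ne_two (by simpa using hne))
    · exact ⟨t, x, s, y, card_inter_vertices_eq_two_iff.mp hc, rfl⟩
    · rw [Finset.inter_comm] at hc
      exact ⟨s, y, t, x, card_inter_vertices_eq_two_iff.mp hc, Set.pair_comm _ _⟩
    · exact absurd hc (card_inter_vertices_opensLeft_ne_two (by simpa using hne))
  · rintro ⟨t, x, t', x', h, rfl⟩
    exact ⟨_, _, by simp, card_inter_vertices_eq_two_iff.mpr h, rfl⟩

lemma opensRight_mem_region :
    Tri.opensRight t x ∈ region n ↔ 0 ≤ t ∧ t ≤ n ∧ 1 ≤ x ∧ x ≤ n + t := by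
  simp only [region, Tri.vertices, Set.mem_ofPred_eq, Finset.mem_insert, Finset.mem_singleton,
    forall_eq_or_imp, forall_eq, ne_eq, reduceCtorEq, not_false_eq_true, implies_true, and_true]
  omega

lemma opensLeft_mem_region :
    Tri.opensLeft t x ∈ region n ↔
      1 ≤ t ∧ t ≤ n + 1 ∧ 1 ≤ x ∧ x ≤ n + t ∧ (t = n + 1 → ¬ Odd x) := by
  simp only [region, Tri.vertices, Set.mem_ofPred_eq, Finset.mem_insert, Finset.mem_singleton,
    forall_eq_or_imp, forall_eq, ne_eq, Tri.opensLeft.injEq, not_and]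
  constructor
  · rintro ⟨h, h'⟩
    exact ⟨by omega, by omega, by omega, by omega, fun ht hx => h' x hx ht rfl⟩
  · rintro ⟨h1, h2, h3, h4, h5⟩
    exact ⟨by omega, fun z hz ht hx => h5 ht (hx ▸ hz)⟩

end Lozenge

section Tiling

/-- The endpoints `2, 4, …, 2 n` of the walkers of the half-hexagon. -/
def evenEnds (n : ℕ) : Fin n → ℤ := fun i => 2 * ((i : ℕ) + 1)

variable {n : ℕ} {T T' : Set (Set Tri)} {t x t' x' s y : ℤ}

lemma strictMono_evenEnds : StrictMono (evenEnds n) := fun i j hij => by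
  have : (i : ℕ) < j := hij
  simp only [evenEnds]
  omega

lemma mem_range_evenEnds : x ∈ Set.range (evenEnds n) ↔ 1 ≤ x ∧ x ≤ 2 * n + 1 ∧ ¬ Odd x := by
  rw [Int.not_odd_iff_even]
  constructor
  · rintro ⟨i, rfl⟩
    simp only [evenEnds]
    exact ⟨by omega, by omega, even_two_mul _⟩
  · rintro ⟨h1, h2, k, rfl⟩
    exact ⟨⟨(k - 1).toNat, by omega⟩, by simp only [evenEnds]; omega⟩

lemma exists_eq_trianglePair (hT : T ∈ tilings n) {q : Set Tri} (hq : q ∈ T) :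
    ∃ t x t' x', ShareSide t x t' x' ∧ q = trianglePair t x t' x' :=
  isLozenge_iff.mp (hT.1 q hq).1

lemma mem_region_of_trianglePair_mem (hT : T ∈ tilings n) (h : trianglePair t x t' x' ∈ T) :
    Tri.opensRight t x ∈ region n ∧ Tri.opensLeft t' x' ∈ region n :=
  trianglePair_subset.mp (hT.1 _ h).2

lemma exists_trianglePair_opensRight (hT : T ∈ tilings n) (h : Tri.opensRight t x ∈ region n) :
    ∃ t' x', ShareSide t x t' x' ∧ trianglePair t x t' x' ∈ T := by
  obtain ⟨q, ⟨hq, hm⟩, -⟩ := hT.2 _ h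
  obtain ⟨s, y, s', y', hs, rfl⟩ := exists_eq_trianglePair hT hq
  obtain ⟨rfl, rfl⟩ := opensRight_mem_trianglePair.mp hm
  exact ⟨s', y', hs, hq⟩

lemma exists_trianglePair_opensLeft (hT : T ∈ tilings n) (h : Tri.opensLeft t' x' ∈ region n) :
    ∃ t x, ShareSide t x t' x' ∧ trianglePair t x t' x' ∈ T := by
  obtain ⟨q, ⟨hq, hm⟩, -⟩ := hT.2 _ h
  obtain ⟨s, y, s', y', hs, rfl⟩ := exists_eq_trianglePair hT hq
  obtain ⟨rfl, rfl⟩ := opensLeft_mem_trianglePair.mp hm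
  exact ⟨s, y, hs, hq⟩

lemma eq_of_mem_of_mem (hT : T ∈ tilings n) {q q' : Set Tri} {a : Tri} (hq : q ∈ T) (hq' : q' ∈ T)
    (ha : a ∈ q) (ha' : a ∈ q') : q = q' :=
  (hT.2 a ((hT.1 q hq).2 ha)).unique ⟨hq, ha⟩ ⟨hq', ha'⟩

lemma opensLeft_unique (hT : T ∈ tilings n) (h : trianglePair t x t' x' ∈ T)
    (h' : trianglePair t x s y ∈ T) : t' = s ∧ x' = y :=
  (trianglePair_inj.mp (eq_of_mem_of_mem (a := .opensRight t x) hT h h' (by simp [trianglePair])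
    (by simp [trianglePair]))).2

lemma opensRight_unique (hT : T ∈ tilings n) (h : trianglePair t x t' x' ∈ T)
    (h' : trianglePair s y t' x' ∈ T) : t = s ∧ x = y :=
  (trianglePair_inj.mp (eq_of_mem_of_mem (a := .opensLeft t' x') hT h h' (by simp [trianglePair])
    (by simp [trianglePair]))).1

lemma eq_of_subset (hT : T ∈ tilings n) (hT' : T' ∈ tilings n) (h : T ⊆ T') : T = T' := by
  refine h.antisymm fun q hq => ?_
  obtain ⟨t, x, t', x', -, rfl⟩ := exists_eq_trianglePair hT' hq
  obtain ⟨s', y', -, hs⟩ :=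
    exists_trianglePair_opensRight hT (mem_region_of_trianglePair_mem hT' hq).1
  obtain ⟨rfl, rfl⟩ := opensLeft_unique hT' hq (h hs)
  exact hs

lemma hasWalker_iff (hT : T ∈ tilings n) :
    HasWalker T t x ↔ (Tri.opensRight t x ∈ region n ∨ Tri.opensLeft t x ∈ region n) ∧
      trianglePair t x t x ∉ T := by
  constructor
  · rintro ⟨q, hq, h⟩
    have hsub := (hT.1 q hq).2
    refine ⟨h.imp (fun h => hsub h.1) (fun h => hsub h.1), fun hv => ?_⟩
    rcases h with ⟨h, h'⟩ | ⟨h, h'⟩ <;>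
      exact h' (eq_of_mem_of_mem hT hq hv h (by simp [trianglePair]) ▸ by simp [trianglePair])
  · rintro ⟨h | h, hv⟩
    · obtain ⟨t', x', -, hq⟩ := exists_trianglePair_opensRight hT h
      refine ⟨_, hq, Or.inl ⟨by simp [trianglePair], fun h' => ?_⟩⟩
      obtain ⟨rfl, rfl⟩ := opensLeft_mem_trianglePair.mp h'
      exact hv hq
    · obtain ⟨t', x', -, hq⟩ := exists_trianglePair_opensLeft hT h
      refine ⟨_, hq, Or.inr ⟨by simp [trianglePair], fun h' => ?_⟩⟩
      obtain ⟨rfl, rfl⟩ := opensRight_mem_trianglePair.mp h'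
      exact hv hq

lemma opensRight_mem_region_of_hasWalker (hT : T ∈ tilings n) (ht : t ≤ n) (h : HasWalker T t x) :
    Tri.opensRight t x ∈ region n := by
  have h := ((hasWalker_iff hT).mp h).1
  rw [opensRight_mem_region, opensLeft_mem_region] at h
  rw [opensRight_mem_region]
  omega

lemma opensLeft_mem_region_of_hasWalker (hT : T ∈ tilings n) (ht : 1 ≤ t) (h : HasWalker T t x) :
    Tri.opensLeft t x ∈ region n := by
  refine ((hasWalker_iff hT).mp h).1.elim (fun hr => ?_) id
  rw [opensRight_mem_region] at hr
  exact opensLeft_mem_region.mpr ⟨ht, by omega, by omega, by omega, by omega⟩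

lemma setOf_hasWalker_zero (hT : T ∈ tilings n) : {x | HasWalker T 0 x} = Set.Icc 1 (n : ℤ) := by
  ext x
  rw [Set.mem_ofPred_eq, hasWalker_iff hT, opensRight_mem_region, opensLeft_mem_region, Set.mem_Icc]
  refine ⟨by omega, fun h => ⟨by omega, fun hv => ?_⟩⟩
  have := opensLeft_mem_region.mp (mem_region_of_trianglePair_mem hT hv).2
  omega

lemma setOf_hasWalker_last (hT : T ∈ tilings n) :
    {x | HasWalker T (n + 1) x} = Set.range (evenEnds n) := by
  ext x
  rw [Set.mem_ofPred_eq, mem_range_evenEnds]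
  constructor
  · intro h
    have hl := opensLeft_mem_region.mp (opensLeft_mem_region_of_hasWalker hT (by omega) h)
    exact ⟨hl.2.2.1, by omega, hl.2.2.2.2 rfl⟩
  · rintro ⟨h1, h2, h3⟩
    refine (hasWalker_iff hT).mpr ⟨Or.inr (opensLeft_mem_region.mpr
      ⟨by omega, le_rfl, h1, by omega, fun _ => h3⟩), fun hv => ?_⟩
    have := opensRight_mem_region.mp (mem_region_of_trianglePair_mem hT hv).1
    omega

open Classical in
/-- The position at time `t + 1` of the walker which is at `x` at time `t`. -/
noncomputable def nextPosition (T : Set (Set Tri)) (t x : ℤ) : ℤ :=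
  if trianglePair t x (t + 1) x ∈ T then x else x + 1

lemma nextPosition_eq_or (T : Set (Set Tri)) (t x : ℤ) :
    nextPosition T t x = x ∨ nextPosition T t x = x + 1 := by
  unfold nextPosition
  split_ifs <;> simp

lemma trianglePair_nextPosition_mem (hT : T ∈ tilings n) (ht : t ≤ n) (h : HasWalker T t x) :
    trianglePair t x (t + 1) (nextPosition T t x) ∈ T := by
  obtain ⟨t', x', hs, hq⟩ :=
    exists_trianglePair_opensRight hT (opensRight_mem_region_of_hasWalker hT ht h)
  unfold nextPosition
  split_ifs with hc
  · exact hc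
  · rcases hs with ⟨rfl, rfl⟩ | ⟨rfl, rfl | rfl⟩
    · exact absurd hq ((hasWalker_iff hT).mp h).2
    · exact absurd hq hc
    · exact hq

lemma hasWalker_of_trianglePair_mem (hT : T ∈ tilings n) (h : trianglePair t x (t + 1) x' ∈ T) :
    HasWalker T t x ∧ HasWalker T (t + 1) x' := by
  obtain ⟨hr, hl⟩ := mem_region_of_trianglePair_mem hT h
  refine ⟨(hasWalker_iff hT).mpr ⟨Or.inl hr, fun hv => ?_⟩,
    (hasWalker_iff hT).mpr ⟨Or.inr hl, fun hv => ?_⟩⟩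
  · have := opensLeft_unique hT h hv
    omega
  · have := opensRight_unique hT h hv
    omega

lemma strictMonoOn_nextPosition (hT : T ∈ tilings n) (ht : t ≤ n) :
    StrictMonoOn (nextPosition T t) {x | HasWalker T t x} := by
  intro x hx y hy hxy
  have hne : nextPosition T t x ≠ nextPosition T t y := fun h => by
    have hx' := trianglePair_nextPosition_mem hT ht hx
    rw [h] at hx'
    have := opensRight_unique hT hx' (trianglePair_nextPosition_mem hT ht hy)
    omega
  have hx' := nextPosition_eq_or T t x
  have hy' := nextPosition_eq_or T t y
  omega

lemma image_nextPosition (hT : T ∈ tilings n) (ht : 0 ≤ t) (ht' : t ≤ n) :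
    nextPosition T t '' {x | HasWalker T t x} = {x | HasWalker T (t + 1) x} := by
  refine Set.Subset.antisymm ?_ fun x' h => ?_
  · rintro _ ⟨x, hx, rfl⟩
    exact (hasWalker_of_trianglePair_mem hT (trianglePair_nextPosition_mem hT ht' hx)).2
  · obtain ⟨s, x, ⟨rfl, rfl⟩ | ⟨hs, -⟩, hq⟩ :=
      exists_trianglePair_opensLeft hT (opensLeft_mem_region_of_hasWalker hT (by omega) h)
    · exact absurd hq ((hasWalker_iff hT).mp h).2
    · obtain rfl := add_right_cancel hs
      have hx := (hasWalker_of_trianglePair_mem hT hq).1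
      exact ⟨x, hx, (opensLeft_unique hT (trianglePair_nextPosition_mem hT ht' hx) hq).2⟩

/-- The positions of the walkers of the tiling `T` at the times `0, 1, …`, each of them followed
from its starting point. -/
noncomputable def walkOfTiling (n : ℕ) (T : Set (Set Tri)) : ℕ → Fin n → ℤ
  | 0, i => (i : ℕ) + 1
  | t + 1, i => nextPosition T t (walkOfTiling n T t i)

lemma range_walkOfTiling (hT : T ∈ tilings n) {t : ℕ} (ht : t ≤ n + 1) :
    Set.range (walkOfTiling n T t) = {x | HasWalker T t x} := by
  induction t with
  | zero =>
    rw [Nat.cast_zero, setOf_hasWalker_zero hT]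
    ext x
    simp only [walkOfTiling, Set.mem_range, Set.mem_Icc]
    exact ⟨by rintro ⟨i, rfl⟩; omega, fun h => ⟨⟨(x - 1).toNat, by omega⟩, by simp; omega⟩⟩
  | succ t ih =>
    rw [Nat.cast_add_one, ← image_nextPosition hT (by omega) (by omega), ← ih (by omega),
      ← Set.range_comp]
    rfl

lemma strictMono_walkOfTiling (hT : T ∈ tilings n) {t : ℕ} (ht : t ≤ n + 1) :
    StrictMono (walkOfTiling n T t) := by
  induction t with
  | zero =>
    intro i j hij
    have : (i : ℕ) < j := hij
    simp only [walkOfTiling]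
    omega
  | succ t ih =>
    have hw : ∀ i, HasWalker T t (walkOfTiling n T t i) :=
      fun i => (range_walkOfTiling hT (by omega)).subset ⟨i, rfl⟩
    exact fun i j hij =>
      strictMonoOn_nextPosition hT (by omega) (hw i) (hw j) (ih (by omega) hij)

lemma walkOfTiling_mem_walks (hT : T ∈ tilings n) :
    (fun t : Fin (n + 1 + 1) => walkOfTiling n T t) ∈ walks n (n + 1) (evenEnds n) := by
  refine ⟨fun t => strictMono_walkOfTiling hT (by omega), fun i => rfl, congrFun ?_,
    fun t i => nextPosition_eq_or _ _ _⟩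
  refine ((strictMono_walkOfTiling hT le_rfl).range_inj strictMono_evenEnds).mp ?_
  rw [range_walkOfTiling hT le_rfl, Nat.cast_add_one, setOf_hasWalker_last hT]

end Tiling

/-! ### The tiling of a configuration of walkers -/

section Walk

variable {n : ℕ}

/-- A walker of `w` is at position `x` at the time `t`, which is an integer here, as in the
coordinates of the triangular lattice. -/
def Occupied (w : Fin (n + 1 + 1) → Fin n → ℤ) (t x : ℤ) : Prop :=
  ∃ s : Fin (n + 1 + 1), (s : ℤ) = t ∧ ∃ i, w s i = x

/-- The triangles `opensRight t x` and `opensLeft t' x'` form a lozenge in the tiling of `w`: either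
this lozenge is swept by a step of a walker, or both triangles lie on an unoccupied vertical
segment in the interior of the half-hexagon. -/
def Joined (w : Fin (n + 1 + 1) → Fin n → ℤ) (t x t' x' : ℤ) : Prop :=
  (t' = t + 1 ∧ ∃ (s : Fin (n + 1)) (i : Fin n),
    (s : ℤ) = t ∧ w s.castSucc i = x ∧ w s.succ i = x') ∨
  (t' = t ∧ x' = x ∧ 1 ≤ t ∧ t ≤ n ∧ 1 ≤ x ∧ x ≤ n + t ∧ ¬ Occupied w t x)

/-- The tiling whose walkers are those of `w`; inverse to `walkOfTiling`. -/
def tilingOfWalk (w : Fin (n + 1 + 1) → Fin n → ℤ) : Set (Set Tri) :=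
  {q | ∃ t x t' x', Joined w t x t' x' ∧ q = trianglePair t x t' x'}

variable {w : Fin (n + 1 + 1) → Fin n → ℤ} {t x t' x' s y : ℤ}

lemma trianglePair_mem_tilingOfWalk :
    trianglePair t x t' x' ∈ tilingOfWalk w ↔ Joined w t x t' x' := by
  constructor
  · rintro ⟨s, y, s', y', h, he⟩
    obtain ⟨⟨rfl, rfl⟩, rfl, rfl⟩ := trianglePair_inj.mp he
    exact h
  · exact fun h => ⟨t, x, t', x', h, rfl⟩

lemma bounds_of_occupied (hw : w ∈ walks n (n + 1) (evenEnds n)) (h : Occupied w t x) :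
    0 ≤ t ∧ t ≤ n + 1 ∧ 1 ≤ x ∧ x ≤ n + t := by
  obtain ⟨s, rfl, i, rfl⟩ := h
  have := Set.mem_Icc.mp (walks_bounds hw s i)
  omega

lemma occupied_zero (hw : w ∈ walks n (n + 1) (evenEnds n)) (h1 : 1 ≤ x) (h2 : x ≤ n) :
    Occupied w 0 x :=
  ⟨0, by simp, ⟨(x - 1).toNat, by omega⟩, by rw [hw.2.1]; simp; omega⟩

lemma occupied_last_iff (hw : w ∈ walks n (n + 1) (evenEnds n)) :
    Occupied w (n + 1) x ↔ 1 ≤ x ∧ x ≤ 2 * n + 1 ∧ ¬ Odd x := by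
  rw [← mem_range_evenEnds]
  constructor
  · rintro ⟨s, hs, i, rfl⟩
    obtain rfl : s = Fin.last (n + 1) := Fin.ext (by simp; omega)
    exact ⟨i, (hw.2.2.1 i).symm⟩
  · rintro ⟨i, rfl⟩
    exact ⟨Fin.last (n + 1), by simp, i, hw.2.2.1 i⟩

lemma joined_self_of_opensRight (hw : w ∈ walks n (n + 1) (evenEnds n))
    (h : Tri.opensRight t x ∈ region n) (ho : ¬ Occupied w t x) : Joined w t x t x := by
  rw [opensRight_mem_region] at h
  have ht : t ≠ 0 := by
    rintro rfl
    exact ho (occupied_zero hw (by omega) (by omega))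
  exact Or.inr ⟨rfl, rfl, by omega, by omega, by omega, by omega, ho⟩

lemma joined_self_of_opensLeft (hw : w ∈ walks n (n + 1) (evenEnds n))
    (h : Tri.opensLeft t x ∈ region n) (ho : ¬ Occupied w t x) : Joined w t x t x := by
  rw [opensLeft_mem_region] at h
  have ht : t ≠ n + 1 := by
    rintro rfl
    exact ho ((occupied_last_iff hw).mpr ⟨by omega, by omega, h.2.2.2.2 rfl⟩)
  exact Or.inr ⟨rfl, rfl, by omega, by omega, by omega, by omega, ho⟩

lemma exists_joined_succ (ht : t ≤ n) (ho : Occupied w t x) : ∃ x', Joined w t x (t + 1) x' := by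
  obtain ⟨s, rfl, i, rfl⟩ := ho
  exact ⟨_, Or.inl ⟨rfl, ⟨s, by omega⟩, i, rfl, rfl, rfl⟩⟩

lemma exists_joined_pred (ht : 1 ≤ t) (ho : Occupied w t x') : ∃ x, Joined w (t - 1) x t x' := by
  obtain ⟨s, rfl, i, rfl⟩ := ho
  have hs : s ≠ 0 := by rintro rfl; simp at ht
  obtain ⟨r, rfl⟩ := Fin.exists_succ_eq.mpr hs
  exact ⟨w r.castSucc i, Or.inl ⟨by ring, r, i, by simp, rfl, rfl⟩⟩

lemma Joined.shareSide (hw : w ∈ walks n (n + 1) (evenEnds n)) (h : Joined w t x t' x') :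
    ShareSide t x t' x' := by
  rcases h with ⟨rfl, s, i, rfl, rfl, rfl⟩ | ⟨ht, hx, -⟩
  · exact Or.inr ⟨rfl, hw.2.2.2 s i⟩
  · exact Or.inl ⟨ht, hx⟩

lemma Joined.mem_region (hw : w ∈ walks n (n + 1) (evenEnds n)) (h : Joined w t x t' x') :
    Tri.opensRight t x ∈ region n ∧ Tri.opensLeft t' x' ∈ region n := by
  rw [opensRight_mem_region, opensLeft_mem_region]
  rcases h with ⟨rfl, s, i, rfl, rfl, rfl⟩ | h
  · have hr := bounds_of_occupied hw ⟨s.castSucc, rfl, i, rfl⟩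
    have ho : Occupied w (s + 1) (w s.succ i) := ⟨s.succ, by simp, i, rfl⟩
    have hl := bounds_of_occupied hw ho
    simp only [Fin.val_castSucc] at hr
    refine ⟨by omega, by omega, by omega, by omega, by omega, fun ht => ?_⟩
    exact ((occupied_last_iff hw).mp (ht ▸ ho)).2.2
  · omega

lemma Joined.left_unique (hw : w ∈ walks n (n + 1) (evenEnds n)) (h : Joined w t x t' x')
    (h' : Joined w t x s y) : t' = s ∧ x' = y := by
  rcases h with ⟨rfl, p, i, hp, hx, rfl⟩ | ⟨rfl, rfl, -, -, -, -, ho⟩ <;>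
    rcases h' with ⟨rfl, r, k, hr, hx', rfl⟩ | ⟨rfl, rfl, -, -, -, -, ho'⟩
  · obtain rfl : p = r := Fin.ext (by omega)
    rw [(hw.1 _).injective (hx.trans hx'.symm)]
    exact ⟨rfl, rfl⟩
  · exact absurd ⟨p.castSucc, hp, i, hx⟩ ho'
  · exact absurd ⟨r.castSucc, hr, k, hx'⟩ ho
  · exact ⟨rfl, rfl⟩

lemma Joined.right_unique (hw : w ∈ walks n (n + 1) (evenEnds n)) (h : Joined w t x t' x')
    (h' : Joined w s y t' x') : t = s ∧ x = y := by
  rcases h with ⟨ht, p, i, hp, hx, hx'⟩ | ⟨rfl, rfl, -, -, -, -, ho⟩ <;>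
    rcases h' with ⟨ht', r, k, hr, hy, hy'⟩ | ⟨rfl, rfl, -, -, -, -, ho'⟩
  · obtain rfl : p = r := Fin.ext (by omega)
    rw [← hx, ← hy, (hw.1 _).injective (hx'.trans hy'.symm)]
    exact ⟨by omega, rfl⟩
  · exact absurd ⟨p.succ, by simp; omega, i, hx'⟩ ho'
  · exact absurd ⟨r.succ, by simp; omega, k, hy'⟩ ho
  · exact ⟨rfl, rfl⟩

lemma existsUnique_tilingOfWalk_opensRight (hw : w ∈ walks n (n + 1) (evenEnds n))
    (h : Tri.opensRight t x ∈ region n) :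
    ∃! q, q ∈ tilingOfWalk w ∧ Tri.opensRight t x ∈ q := by
  obtain ⟨t', x', hj⟩ : ∃ t' x', Joined w t x t' x' := by
    by_cases ho : Occupied w t x
    · exact ⟨_, exists_joined_succ (opensRight_mem_region.mp h).2.1 ho⟩
    · exact ⟨_, _, joined_self_of_opensRight hw h ho⟩
  refine ⟨trianglePair t x t' x', ⟨⟨_, _, _, _, hj, rfl⟩, by simp [trianglePair]⟩, ?_⟩
  rintro _ ⟨⟨s, y, s', y', hj', rfl⟩, hm⟩
  obtain ⟨rfl, rfl⟩ := opensRight_mem_trianglePair.mp hm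
  exact trianglePair_inj.mpr ⟨⟨rfl, rfl⟩, hj'.left_unique hw hj⟩

lemma existsUnique_tilingOfWalk_opensLeft (hw : w ∈ walks n (n + 1) (evenEnds n))
    (h : Tri.opensLeft t x ∈ region n) :
    ∃! q, q ∈ tilingOfWalk w ∧ Tri.opensLeft t x ∈ q := by
  obtain ⟨s, y, hj⟩ : ∃ s y, Joined w s y t x := by
    by_cases ho : Occupied w t x
    · exact ⟨_, exists_joined_pred (opensLeft_mem_region.mp h).1 ho⟩
    · exact ⟨_, _, joined_self_of_opensLeft hw h ho⟩
  refine ⟨trianglePair s y t x, ⟨⟨_, _, _, _, hj, rfl⟩, by simp [trianglePair]⟩, ?_⟩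
  rintro _ ⟨⟨s', y', t', x', hj', rfl⟩, hm⟩
  obtain ⟨rfl, rfl⟩ := opensLeft_mem_trianglePair.mp hm
  exact trianglePair_inj.mpr ⟨hj'.right_unique hw hj, rfl, rfl⟩

lemma tilingOfWalk_mem_tilings (hw : w ∈ walks n (n + 1) (evenEnds n)) :
    tilingOfWalk w ∈ tilings n := by
  refine ⟨?_, ?_⟩
  · rintro _ ⟨t, x, t', x', h, rfl⟩
    exact ⟨isLozenge_iff.mpr ⟨t, x, t', x', h.shareSide hw, rfl⟩,
      trianglePair_subset.mpr (h.mem_region hw)⟩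
  · rintro (⟨t, x⟩ | ⟨t, x⟩) h
    · exact existsUnique_tilingOfWalk_opensRight hw h
    · exact existsUnique_tilingOfWalk_opensLeft hw h

lemma hasWalker_tilingOfWalk_iff_occupied (hw : w ∈ walks n (n + 1) (evenEnds n)) :
    HasWalker (tilingOfWalk w) t x ↔ Occupied w t x := by
  rw [hasWalker_iff (tilingOfWalk_mem_tilings hw), trianglePair_mem_tilingOfWalk]
  constructor
  · rintro ⟨hr, hj⟩
    by_contra ho
    exact hj (hr.elim (joined_self_of_opensRight hw · ho) (joined_self_of_opensLeft hw · ho))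
  · intro ho
    refine ⟨?_, ?_⟩
    · have hb := bounds_of_occupied hw ho
      by_cases ht : t ≤ n
      · exact Or.inl (opensRight_mem_region.mpr ⟨hb.1, ht, hb.2.2⟩)
      · obtain ⟨y, hy⟩ := exists_joined_pred (by omega) ho
        exact Or.inr (hy.mem_region hw).2
    · rintro (⟨h, -⟩ | ⟨-, -, -, -, -, -, h⟩)
      · omega
      · exact h ho

lemma hasWalker_tilingOfWalk_iff (hw : w ∈ walks n (n + 1) (evenEnds n)) (s : Fin (n + 1 + 1))
    (x : ℤ) : HasWalker (tilingOfWalk w) (s : ℕ) x ↔ ∃ i, w s i = x := by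
  rw [hasWalker_tilingOfWalk_iff_occupied hw]
  constructor
  · rintro ⟨r, hr, h⟩
    obtain rfl : r = s := Fin.ext (by omega)
    exact h
  · exact fun h => ⟨s, rfl, h⟩

lemma injOn_tilingOfWalk : Set.InjOn (tilingOfWalk (n := n)) (walks n (n + 1) (evenEnds n)) := by
  intro w hw w' hw' h
  funext s
  refine ((hw.1 s).range_inj (hw'.1 s)).mp (Set.ext fun x => ?_)
  rw [Set.mem_range, Set.mem_range, ← hasWalker_tilingOfWalk_iff hw,
    ← hasWalker_tilingOfWalk_iff hw', h]

lemma tilingOfWalk_walkOfTiling {T : Set (Set Tri)} (hT : T ∈ tilings n) :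
    tilingOfWalk (fun t : Fin (n + 1 + 1) => walkOfTiling n T t) = T := by
  refine eq_of_subset (tilingOfWalk_mem_tilings (walkOfTiling_mem_walks hT)) hT ?_
  rintro _ ⟨t, x, t', x', ⟨rfl, s, i, rfl, rfl, rfl⟩ | ⟨rfl, rfl, h0, h1, h2, h3, ho⟩, rfl⟩
  · exact trianglePair_nextPosition_mem hT (by omega)
      ((range_walkOfTiling hT (by omega)).subset ⟨i, rfl⟩)
  · by_contra hv
    have hwalker := (hasWalker_iff hT).mpr
      ⟨Or.inl (opensRight_mem_region.mpr ⟨by omega, h1, h2, h3⟩), hv⟩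
    lift t' to ℕ using by omega
    exact ho ⟨⟨t', by omega⟩, rfl, (range_walkOfTiling hT (by omega)).superset hwalker⟩

lemma image_tilingOfWalk : tilingOfWalk '' walks n (n + 1) (evenEnds n) = tilings n := by
  refine Set.Subset.antisymm ?_ fun T hT =>
    ⟨_, walkOfTiling_mem_walks hT, tilingOfWalk_walkOfTiling hT⟩
  rintro _ ⟨w, hw, rfl⟩
  exact tilingOfWalk_mem_tilings hw

lemma walks_evenEnds_nonempty (n : ℕ) : (walks n (n + 1) (evenEnds n)).Nonempty := by
  refine ⟨fun t i => (i : ℕ) + 1 + (min (t : ℕ) ((i : ℕ) + 1) : ℕ), fun t i j hij => ?_,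
    fun i => by simp, fun i => ?_, fun t i => ?_⟩
  · have : (i : ℕ) < j := hij
    simp only
    omega
  · simp only [Fin.val_last, evenEnds]
    omega
  · simp only [Fin.val_succ, Fin.val_castSucc]
    omega

lemma tilings_finite (n : ℕ) : (tilings n).Finite :=
  image_tilingOfWalk (n := n) ▸ (walks_finite n (n + 1) (evenEnds n)).image _

lemma tilings_nonempty (n : ℕ) : (tilings n).Nonempty :=
  image_tilingOfWalk (n := n) ▸ (walks_evenEnds_nonempty n).image _

theorem uniformProb_tilings_eq_det_novakKernel {ι : Type*} [Fintype ι] [DecidableEq ι]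
    {t : ι → Fin (n + 1 + 1)} {x : ι → ℤ} (htx : Function.Injective fun a => (t a, x a)) :
    uniformProb (tilings n) {T | ∀ a, HasWalker T (t a : ℕ) (x a)} =
      (Matrix.of fun a b => novakKernel n (t a : ℕ) (x a) (t b : ℕ) (x b)).det := by
  have himage := uniformProb_image (E := {w | ∀ a, ∃ i, w (t a) i = x a})
    (E' := {T | ∀ a, HasWalker T (t a : ℕ) (x a)}) (injOn_tilingOfWalk (n := n))
    fun w hw => forall_congr' fun a => hasWalker_tilingOfWalk_iff hw (t a) (x a)
  rw [← image_tilingOfWalk, himage]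
  simp only [novakKernel_eq_walkKernel]
  exact uniformProb_walks_eq_det_walkKernel (walks_evenEnds_nonempty n) htx

end Walk

end HalfHexagon

open HalfHexagon in
theorem corollary2 :
    -- the half-hexagon of order `n`
    (∀ n : ℕ, (tilings n).Finite ∧ (tilings n).Nonempty ∧
      ∀ (m : ℕ) (t : Fin m → Fin (n + 2)) (x : Fin m → ℤ),
        Function.Injective (fun a => (t a, x a)) →
        uniformProb (tilings n) {T | ∀ a, HasWalker T (t a : ℕ) (x a)} =
          Matrix.det (Matrix.of fun a b : Fin m =>
            novakKernel n (t a : ℕ) (x a) (t b : ℕ) (x b))) ∧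
    -- densely packed walkers with arbitrary end time and endpoints
    (∀ (n N : ℕ) (y : Fin n → ℤ), (walks n N y).Nonempty →
      (walks n N y).Finite ∧
      ∀ (m : ℕ) (t : Fin m → Fin (N + 1)) (x : Fin m → ℤ),
        Function.Injective (fun a => (t a, x a)) →
        uniformProb (walks n N y) {w | ∀ a, ∃ i, w (t a) i = x a} =
          Matrix.det (Matrix.of fun a b : Fin m =>
            walkKernel n N y (t a : ℕ) (x a) (t b : ℕ) (x b))) ∧
    -- the first kernel is the second one for `N = n + 1` and `y_i = 2 i`
    (∀ (n : ℕ) (r x s z : ℤ),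
      novakKernel n r x s z = walkKernel n (n + 1) (fun i => 2 * ((i : ℕ) + 1)) r x s z) := by
  exact ⟨fun n => ⟨tilings_finite n, tilings_nonempty n, fun m t x htx =>
      uniformProb_tilings_eq_det_novakKernel htx⟩,
    fun n N y hne => ⟨walks_finite n N y, fun m t x htx =>
      uniformProb_walks_eq_det_walkKernel hne htx⟩,
    novakKernel_eq_walkKernel⟩
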